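/- Let $\Sigma$ be an alphabet with exactly two letters. For a finite word $w$ over $\Sigma$ of length $|w|$, let $f_w(n)$ be the number of distinct factors (contiguous subwords) of $w$ of length $n$; let $R_w$ be the least $n\ge 0$ such that no word $z$ of length $n$ is right special in $w$ (that is, such that $za$ and $zb$ are both factors of $w$ for some letters $a\ne b$); and, for $w$ non-empty, let $K_w$ be the least length of a suffix of $w$ that occurs exactly once in $w$. Put $m_w=\min\{R_w,K_w\}$ and $M_w=\max\{R_w,K_w\}$. - A non-empty word $w$ is *trapezoidal* if $f_w(i)=i+1$ for $0\le i\le m_w$, $f_w(i+1)=f_w(i)$ for $m_w\le i\le M_w-1$, and $f_w(i+1)=f_w(i)-1$ for $M_w\le i\le |w|$. - A word $w$ is *closed* if it is empty or it has a factor, different from $w$, that occurs exactly twice in $w$, once as a prefix and once as a suffix. - A word $w$ is *Sturmian* if it is balanced, i.e. $\bigl||u|_a-|v|_a\bigr|\le 1$ for every letter $a$ and all factors $u,v$ of $w$ with $|u|=|v|$, where $|u|_a$ is the number of occurrences of $a$ in $u$. - A *palindrome* is a word equal to its reversal; the empty word is a palindrome. (The empty word has $|w|+1$ occurrences in $w$.)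 **Proposition.** Let $w$ be a closed trapezoidal word over $\Sigma$, and let $h_w$ be its longest repeated prefix, i.e. the longest prefix of $w$ that occurs at least twice in $w$. Then $w$ is a Sturmian palindrome (both Sturmian and a palindrome) if and only if $h_w$ is a palindrome. -/

import Mathlib

/-!
Finite words over an alphabet `α` are lists `List α`.  Factors, prefixes and suffixes are
Mathlib's `z <:+: w`, `z <+: w`, `z <:+ w`; palindromes are `List.Palindrome`.
-/

namespace Word

variable {α : Type*}

/-- The positions (counted from `0`) at which `z` occurs in `w`. -/
def occurrences [DecidableEq α] (z w : List α) : Finset ℕ :=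
  {i ∈ Finset.range (w.length + 1) | z <+: w.drop i}

/-- The factor complexity `f_w(n)`: the number of distinct factors of `w` of length `n`. -/
noncomputable def complexity (w : List α) (n : ℕ) : ℕ :=
  {z : List α | z <:+: w ∧ z.length = n}.ncard

/-- `z` is right special in `w`: it occurs in `w` followed by two different letters. -/
def RightSpecial (z w : List α) : Prop :=
  ∃ a b : α, a ≠ b ∧ (z ++ [a]) <:+: w ∧ (z ++ [b]) <:+: w

/-- `R_w`: the minimal length for which `w` has no right special factor of that length. -/
noncomputable def R (w : List α) : ℕ :=
  sInf {n : ℕ | ∀ z : List α, z.length = n → ¬ RightSpecial z w}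

/-- `K_w`: the minimal length of a suffix of `w` that occurs only once in `w`. -/
noncomputable def K [DecidableEq α] (w : List α) : ℕ :=
  sInf {n : ℕ | ∃ z : List α, z <:+ w ∧ z.length = n ∧ (occurrences z w).card = 1}

/-- Trapezoidal words, with `m_w = min (R_w, K_w)` and `M_w = max (R_w, K_w)`: `w` is non-empty and
`f_w(i) = i + 1` for `0 ≤ i ≤ m_w`, `f_w(i + 1) = f_w(i)` for `m_w ≤ i ≤ M_w - 1`, and
`f_w(i + 1) = f_w(i) - 1` for `M_w ≤ i ≤ |w|`. -/
def Trapezoidal [DecidableEq α] (w : List α) : Prop :=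
  w ≠ [] ∧
  (∀ i, i ≤ min (R w) (K w) → complexity w i = i + 1) ∧
  (∀ i, min (R w) (K w) ≤ i → i < max (R w) (K w) → complexity w (i + 1) = complexity w i) ∧
  (∀ i, max (R w) (K w) ≤ i → i ≤ w.length → complexity w (i + 1) + 1 = complexity w i)

/-- `w` is closed: it is empty, or it has a factor different from `w` that occurs exactly twice
in `w`, as a prefix and as a suffix. -/
def Closed [DecidableEq α] (w : List α) : Prop :=
  w = [] ∨ ∃ z : List α, z ≠ w ∧ z <+: w ∧ z <:+ w ∧ (occurrences z w).card = 2

/-- Finite Sturmian words, i.e. balanced words: any two factors of the same length contain the same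
number of occurrences of each letter up to one.  Used over a two-letter alphabet. -/
def Sturmian [DecidableEq α] (w : List α) : Prop :=
  ∀ (a : α) (u v : List α), u <:+: w → v <:+: w → u.length = v.length →
    |(u.count a : ℤ) - (v.count a : ℤ)| ≤ 1

/-- `h` is the longest repeated prefix of `w`, that is, the longest among the prefixes of `w` that
have at least two occurrences in `w`. -/
def IsLongestRepeatedPrefix [DecidableEq α] (h w : List α) : Prop :=
  (h <+: w ∧ 2 ≤ (occurrences h w).card) ∧
  ∀ z : List α, z <+: w → 2 ≤ (occurrences z w).card → z.length ≤ h.length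

end Word

/-! Closedness makes `h` a border of `w` occurring only at the two ends, so `w` has period p = |w| -
|h|, and K = |h| + 1. The trapezoid shape gives R + K = |w|, hence R = p - 1, and for p ≥ 2 some
factor of length p - 2 is right special. Read `w` on the cycle `ZMod p`: the two occurrences of that
factor differ by a shift d that preserves every letter except two adjacent ones, which it swaps.
Such a d is a unit, and then the cyclic word is balanced (`SwapShift.abs_sum_window_sub_le`) and
symmetric (`SwapShift.reflect`).

So `w` is Sturmian whatever `h` is, and its reversal is another window of the cyclic word. If `h` is
a palindrome, this window starts with `h`, which occurs in `w` at no position below p but 0, so the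
window is `w`. Conversely, reversing a palindrome `w` exchanges its prefix and suffix `h`. -/

namespace Word

open Finset

/-! ### Integer functions on a cycle under a swapping shift -/

section Periodic

variable {p : ℕ}

/-- Shifting `y` by `d` changes it only at `c` and `c + 1`, by opposite amounts `ε` and `-ε`. -/
def SwapShift (y : ZMod p → ℤ) (d c : ZMod p) (ε : ℤ) : Prop :=
  ∀ n, y (n + d) - y n = ε * ((if n = c then 1 else 0) - (if n = c + 1 then 1 else 0))

/-- The changes at c and c + 1 telescope along the window, leaving its two ends. -/
theorem SwapShift.sum_window {y : ZMod p → ℤ} {d c : ZMod p} {ε : ℤ}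
    (hy : SwapShift y d c ε) (L : ℕ) (n : ZMod p) :
    ∑ t ∈ range L, y (n + d + t) - ∑ t ∈ range L, y (n + t)
      = ε * ((if n + L = c + 1 then 1 else 0) - (if n = c + 1 then 1 else 0)) := by
  induction L with
  | zero => simp
  | succ L ih =>
    rw [sum_range_succ, sum_range_succ]
    have h := hy (n + L)
    have e1 : n + ((L + 1 : ℕ) : ZMod p) = c + 1 ↔ n + L = c := by
      push_cast; rw [← add_assoc, add_left_inj]
    simp only [e1]
    rw [show n + (L : ZMod p) + d = n + d + L by ring] at h
    linarith

variable [NeZero p]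

/-- The total over the cycle is shift-invariant, so the two exceptional changes cancel. -/
theorem swapShift_of_eq_off (hp : 2 ≤ p) {y : ZMod p → ℤ} {d c : ZMod p}
    (hy : ∀ n, n ≠ c → n ≠ c + 1 → y (n + d) = y n) :
    SwapShift y d c (y (c + d) - y c) := by
  have : Fact (1 < p) := ⟨hp⟩
  have hne : c ≠ c + 1 := by simp
  have hsum : ∑ n, (y (n + d) - y n) = 0 := by
    rw [sum_sub_distrib, sub_eq_zero]
    exact Fintype.sum_equiv (Equiv.addRight d) _ _ fun _ => rfl
  have hpair : ∑ n ∈ ({c, c + 1} : Finset (ZMod p)), (y (n + d) - y n) = 0 := by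
    rw [← hsum]
    refine sum_subset (subset_univ _) fun n _ hn => ?_
    simp only [mem_insert, mem_singleton, not_or] at hn
    rw [hy n hn.1 hn.2, sub_self]
  rw [sum_pair hne] at hpair
  intro n
  by_cases h1 : n = c
  · subst h1; simp
  by_cases h2 : n = c + 1
  · subst h2
    rw [if_neg h1, if_pos rfl]
    linarith
  · simp [h1, h2, hy n h1 h2]

/-- Otherwise the walk c, c + d, c + 2d, ... never meets c + 1; all its changes are 0 or ε, the
first is ε, yet after p steps they sum to zero. -/
theorem SwapShift.exists_mul_eq_one (hp : 2 ≤ p) {y : ZMod p → ℤ} {d c : ZMod p} {ε : ℤ}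
    (hy : SwapShift y d c ε) (hε : ε ≠ 0) : ∃ e : ZMod p, e * d = 1 := by
  have : Fact (1 < p) := ⟨hp⟩
  by_contra! hd
  have htel := sum_range_sub (fun m : ℕ => y (c + m * d)) p
  simp only [CharP.cast_eq_zero, zero_mul, add_zero, sub_self, Nat.cast_zero] at htel
  have hstep : ∀ m : ℕ, y (c + ((m + 1 : ℕ) : ZMod p) * d) - y (c + m * d)
      = ε * (if (m : ZMod p) * d = 0 then 1 else 0) := by
    intro m
    have h := hy (c + m * d)
    rw [if_neg (fun h' => hd m (add_left_cancel h')), sub_zero] at h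
    rw [show c + ((m + 1 : ℕ) : ZMod p) * d = c + m * d + d by push_cast; ring, h]
    simp
  simp only [hstep, ← mul_sum] at htel
  rcases mul_eq_zero.1 htel with h | h
  · exact hε h
  · have := (sum_eq_zero_iff_of_nonneg (fun m _ => by split_ifs <;> simp)).1 h 0
      (mem_range.2 (by omega))
    simp at this

theorem eq_zero_apply_of_shift_invariant {F : ZMod p → ℤ} {d e : ZMod p} (hde : e * d = 1)
    (hF : ∀ n, F (n + d) = F n) (n : ZMod p) : F n = F 0 := by
  have key : ∀ m : ℕ, F (m * d) = F 0 := by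
    intro m
    induction m with
    | zero => simp
    | succ m ih => rw [← ih, ← hF (m * d)]; push_cast; ring_nf
  have := key (n * e).val
  rwa [ZMod.natCast_zmod_val, mul_assoc, hde, mul_one] at this

/-- The reflection exchanges the two exceptional steps, so y(s - n) - y(n) is invariant under d,
hence constant; being odd under the reflection, it vanishes. -/
theorem SwapShift.reflect {y : ZMod p → ℤ} {d c e : ZMod p} {ε : ℤ}
    (hy : SwapShift y d c ε) (hde : e * d = 1) (n : ZMod p) :
    y (2 * c + 1 + d - n) = y n := by
  set s := 2 * c + 1 + d with hs
  have hinv : ∀ n, y (s - (n + d)) - y (n + d) = y (s - n) - y n := by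
    intro n
    have h1 := hy n
    have h2 := hy (s - (n + d))
    rw [show s - (n + d) + d = s - n by ring] at h2
    have e1 : s - (n + d) = c ↔ n = c + 1 := by
      rw [hs]; constructor <;> intro h <;> linear_combination -h
    have e2 : s - (n + d) = c + 1 ↔ n = c := by
      rw [hs]; constructor <;> intro h <;> linear_combination -h
    simp only [e1, e2] at h2
    linarith
  have hconst := eq_zero_apply_of_shift_invariant (F := fun n => y (s - n) - y n) hde hinv
  have h1 := hconst n
  have h2 := hconst (s - n)
  simp only [sub_sub_cancel] at h1 h2
  linarith

/-- Steps of d visit every residue. Starting just after c + 1, the walk is back there only at step p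
- 1, so before that the window sum changes at most once, by ε. -/
theorem SwapShift.abs_sum_window_sub_le {y : ZMod p → ℤ} {d c e : ZMod p} {ε : ℤ}
    (hy : SwapShift y d c ε) (hde : e * d = 1) (hε : |ε| ≤ 1) (L : ℕ) (n n' : ZMod p) :
    |∑ t ∈ range L, y (n + t) - ∑ t ∈ range L, y (n' + t)| ≤ 1 := by
  set n₀ := c + 1 + d with hn₀
  set S : ZMod p → ℤ := fun n => ∑ t ∈ range L, y (n + t) with hS
  -- The step at which the end n + L of the window meets c + 1.
  set q := ((c + 1 - L - n₀) * e).val with hq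
  have key : ∀ j : ℕ, j < p → S (n₀ + j * d) = S n₀ + ε * (if q < j then 1 else 0) := by
    intro j
    induction j with
    | zero => simp
    | succ j ih =>
      intro hj
      have h := hy.sum_window L (n₀ + j * d)
      have hne : n₀ + j * d ≠ c + 1 := by
        intro h0
        have h1 : ((j + 1 : ℕ) : ZMod p) = 0 := by
          push_cast
          linear_combination (-(j : ZMod p) - 1) * hde + e * (h0 + hn₀)
        rw [ZMod.natCast_eq_zero_iff] at h1
        exact absurd (Nat.le_of_dvd (by omega) h1) (by omega)
      have hiff : n₀ + j * d + L = c + 1 ↔ j = q := by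
        constructor
        · intro h0
          have h1 : (j : ZMod p) = (c + 1 - L - n₀) * e := by
            linear_combination e * h0 - (j : ZMod p) * hde
          rw [hq, ← h1, ZMod.val_natCast_of_lt (by omega)]
        · intro h0
          have h1 : (j : ZMod p) = (c + 1 - L - n₀) * e := by
            rw [h0, hq, ZMod.natCast_zmod_val]
          linear_combination d * h1 + (c + 1 - L - n₀) * hde
      simp only [hiff, if_neg hne, sub_zero] at h
      have h2 := ih (by omega)
      simp only [hS] at h2 ⊢
      rw [show n₀ + ((j + 1 : ℕ) : ZMod p) * d = n₀ + j * d + d by push_cast; ring]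
      rcases lt_trichotomy q j with hlt | heq | hgt
      · rw [if_pos hlt] at h2
        rw [if_neg (by omega)] at h
        rw [if_pos (by omega)]
        linarith
      · rw [if_neg (by omega)] at h2
        rw [if_pos heq.symm] at h
        rw [if_pos (by omega)]
        linarith
      · rw [if_neg (by omega)] at h2
        rw [if_neg (by omega)] at h
        rw [if_neg (by omega)]
        linarith
  have hval : ∀ n, ∃ b : Prop, ∃ _ : Decidable b, S n = S n₀ + ε * (if b then 1 else 0) := by
    intro n
    refine ⟨q < ((n - n₀) * e).val, inferInstance, ?_⟩
    rw [← key _ (ZMod.val_lt _), ZMod.natCast_zmod_val]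
    congr 1
    linear_combination (-(n - n₀)) * hde
  change |S n - S n'| ≤ 1
  obtain ⟨b, _, hb⟩ := hval n
  obtain ⟨b', _, hb'⟩ := hval n'
  rw [hb, hb']
  rw [abs_le] at hε ⊢
  split_ifs <;> constructor <;> linarith [hε.1, hε.2]

end Periodic

/-! ### Windows of periodic words -/

section Window

variable {α : Type*} {p : ℕ}

/-- The factor of length `L` starting at position `n` of the `p`-periodic word `x`. -/
def window (x : ZMod p → α) (n : ZMod p) (L : ℕ) : List α :=
  (List.range L).map fun t : ℕ => x (n + t)

@[simp] theorem length_window (x : ZMod p → α) (n : ZMod p) (L : ℕ) :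
    (window x n L).length = L := by simp [window]

@[simp] theorem getElem_window (x : ZMod p → α) (n : ZMod p) (L t : ℕ)
    (ht : t < (window x n L).length) : (window x n L)[t] = x (n + t) := by simp [window]

theorem take_window (x : ZMod p → α) (n : ZMod p) {k L : ℕ} (h : k ≤ L) :
    (window x n L).take k = window x n k := by
  refine List.ext_getElem (by simpa using h) fun t _ _ => by simp

theorem drop_window (x : ZMod p → α) (n : ZMod p) (k L : ℕ) :
    (window x n L).drop k = window x (n + k) (L - k) := by
  refine List.ext_getElem (by simp) fun t _ _ => by simp [add_assoc]

theorem exists_window_of_infix {x : ZMod p → α} {n : ZMod p} {L : ℕ} {u : List α}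
    (hu : u <:+: window x n L) : ∃ m, u = window x m u.length := by
  obtain ⟨s, t, h⟩ := hu
  refine ⟨n + s.length, List.ext_getElem (by simp) fun i hi _ => ?_⟩
  have h1 : (s ++ u ++ t)[s.length + i]'(by simp; omega) = u[i] := by
    simp [List.getElem_append_left, hi]
  rw [← h1]
  simp only [h, getElem_window]
  push_cast
  rw [add_assoc]

theorem count_window [DecidableEq α] (x : ZMod p → α) (n : ZMod p) (L : ℕ) (a : α) :
    ((window x n L).count a : ℤ) = ∑ t ∈ range L, if x (n + t) = a then 1 else 0 := by
  induction L with
  | zero => simp [window]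
  | succ L ih =>
    rw [sum_range_succ, ← ih, window, List.range_succ, List.map_append, List.count_append,
      ← window]
    simp [List.count_singleton]

/-- The reversal starts at the mirror image of the last position n + L - 1. -/
theorem reverse_window {x : ZMod p → α} {s : ZMod p} (hx : ∀ n, x (s - n) = x n)
    (n : ZMod p) (L : ℕ) : (window x n L).reverse = window x (s + 1 - n - L) L := by
  refine List.ext_getElem (by simp) fun t h1 _ => ?_
  simp only [List.length_reverse, length_window] at h1
  rw [List.getElem_reverse, getElem_window, getElem_window, ← hx, length_window]
  congr 1
  rw [Nat.cast_sub (by omega), Nat.cast_sub (by omega)]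
  push_cast
  ring

/-- A periodic word with a right special factor two letters shorter than its period is
balanced and invariant under a reflection. -/
theorem balanced_and_reflect_of_rightSpecial [DecidableEq α] [NeZero p] (hp : 2 ≤ p)
    {x : ZMod p → α} {n : ZMod p} {L : ℕ} {z : List α} (hz : z.length = p - 2)
    (hrs : RightSpecial z (window x n L)) :
    Sturmian (window x n L) ∧ ∃ s, ∀ m, x (s - m) = x m := by
  obtain ⟨a, b, hab, ha, hb⟩ := hrs
  obtain ⟨i, hi⟩ := exists_window_of_infix ha
  obtain ⟨j, hj⟩ := exists_window_of_infix hb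
  have hlen : ∀ l : α, (z ++ [l]).length = p - 1 := fun l => by simp; omega
  rw [hlen] at hi hj
  have hxi : ∀ t (ht : t < p - 1), x (i + t) = (z ++ [a])[t]'(by rw [hlen]; exact ht) :=
    fun t ht => by simp only [hi, getElem_window]
  have hxj : ∀ t (ht : t < p - 1), x (j + t) = (z ++ [b])[t]'(by rw [hlen]; exact ht) :=
    fun t ht => by simp only [hj, getElem_window]
  set d := j - i with hd
  set c := i + ((p - 2 : ℕ) : ZMod p) with hc
  have hca : x c = a := by rw [hc, hxi _ (by omega)]; simp [hz]
  have hcb : x (c + d) = b := by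
    rw [hc, hd, show i + ((p - 2 : ℕ) : ZMod p) + (j - i) = j + ((p - 2 : ℕ) : ZMod p) by ring,
      hxj _ (by omega)]
    simp [hz]
  -- Offsets p - 2 and p - 1 from i are c and c + 1; at all smaller ones both occurrences read z.
  have hoff : ∀ m, m ≠ c → m ≠ c + 1 → x (m + d) = x m := by
    intro m h1 h2
    have hm : m = i + ((m - i).val : ZMod p) := by rw [ZMod.natCast_zmod_val]; ring
    have hlt := ZMod.val_lt (m - i)
    set t := (m - i).val with ht
    have ht1 : t ≠ p - 2 := fun h => h1 (by rw [hm, h])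
    have ht2 : t ≠ p - 1 := fun h => h2 (by
      rw [hm, h, hc, show p - 1 = p - 2 + 1 by omega]; push_cast; ring)
    rw [hm, hxi t (by omega), hd, show i + (t : ZMod p) + (j - i) = j + t by ring,
      hxj t (by omega), List.getElem_append_left (by omega), List.getElem_append_left (by omega)]
  have hswap : ∀ l : α, SwapShift (fun m => if x m = l then (1 : ℤ) else 0) d c
      ((if x (c + d) = l then 1 else 0) - if x c = l then 1 else 0) := fun l =>
    swapShift_of_eq_off (y := fun m => if x m = l then (1 : ℤ) else 0) hp fun m h1 h2 => by
      simp only [hoff m h1 h2]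
  obtain ⟨e, he⟩ := (hswap a).exists_mul_eq_one hp (by simp [hca, hcb, hab.symm])
  refine ⟨fun l u v hu hv huv => ?_, 2 * c + 1 + d, fun m => ?_⟩
  · obtain ⟨m, hm⟩ := exists_window_of_infix hu
    obtain ⟨m', hm'⟩ := exists_window_of_infix hv
    rw [hm, hm', count_window, count_window, huv]
    refine (hswap l).abs_sum_window_sub_le he ?_ _ _ _
    split_ifs <;> simp
  · have := (hswap (x m)).reflect he m
    simpa using this

theorem exists_eq_window [NeZero p] {w h : List α} (hlen : p + h.length = w.length)
    (hpre : h <+: w) (hsuf : h <:+ w) : ∃ x : ZMod p → α, w = window x 0 w.length := by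
  have hp : 0 < p := Nat.pos_of_ne_zero (NeZero.ne p)
  have hper : ∀ t (ht : p + t < w.length), w[p + t] = w[t]'(by omega) := by
    intro t ht
    have h1 : h = w.drop p := by
      rw [List.suffix_iff_eq_drop] at hsuf
      rw [hsuf]; congr 1; omega
    have h2 : h[t]'(by omega) = w[t]'(by omega) := hpre.getElem (by omega)
    rw [← h2]
    simp only [h1, List.getElem_drop]
  refine ⟨fun n => w[n.val]'((ZMod.val_lt n).trans_le (by omega)),
    List.ext_getElem (by simp) fun t ht _ => ?_⟩
  simp only [getElem_window, zero_add, ZMod.val_natCast]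
  induction t using Nat.strong_induction_on with
  | _ t ih =>
    rcases lt_or_ge t p with h | h
    · simp only [Nat.mod_eq_of_lt h]
    · obtain ⟨r, rfl⟩ := Nat.exists_eq_add_of_le h
      rw [hper r ht, ih r (by omega) (by omega) (by simp; omega)]
      simp only [Nat.add_mod_left]

end Window

/-! ### Full-length complexity and a bound on R -/

section Length

variable {α : Type*}

theorem complexity_length (w : List α) : complexity w w.length = 1 := by
  rw [complexity, Set.ncard_eq_one]
  refine ⟨w, Set.eq_singleton_iff_unique_mem.2 ⟨⟨List.infix_rfl, rfl⟩, ?_⟩⟩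
  rintro z ⟨hz, hl⟩
  exact hz.sublist.eq_of_length hl

theorem R_le_length (w : List α) : R w ≤ w.length := by
  refine Nat.sInf_le fun z hz => ?_
  rintro ⟨a, b, -, h, -⟩
  have := h.length_le
  simp at this
  omega

end Length

/-! ### Borders of closed words and the values of K and R -/

section Closed

variable {α : Type*} [DecidableEq α]

theorem mem_occurrences {z w : List α} {i : ℕ} :
    i ∈ occurrences z w ↔ i ≤ w.length ∧ z <+: w.drop i := by
  simp [occurrences]

theorem zero_mem_occurrences {z w : List α} (h : z <+: w) : 0 ∈ occurrences z w :=
  mem_occurrences.2 ⟨Nat.zero_le _, by simpa using h⟩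

theorem sub_mem_occurrences {z w : List α} (h : z <:+ w) :
    w.length - z.length ∈ occurrences z w :=
  mem_occurrences.2 ⟨Nat.sub_le _ _, by rw [← List.suffix_iff_eq_drop.1 h]⟩

theorem occurrences_eq_of_border {z w : List α} (hne : z ≠ w) (hpre : z <+: w) (hsuf : z <:+ w)
    (hcard : (occurrences z w).card = 2) :
    z.length < w.length ∧ occurrences z w = {0, w.length - z.length} := by
  have hlt : z.length < w.length :=
    lt_of_le_of_ne hpre.length_le fun h => hne (hpre.eq_of_length h)
  refine ⟨hlt, (eq_of_subset_of_card_le ?_ ?_).symm⟩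
  · intro i hi
    rcases mem_insert.1 hi with rfl | hi
    · exact zero_mem_occurrences hpre
    · rw [mem_singleton.1 hi]; exact sub_mem_occurrences hsuf
  · rw [hcard, card_pair (by omega)]

/-- A second occurrence of `h` is one of the border z as well, hence at |w| - |z|, where only |z|
letters remain; so `h` = z. -/
theorem Closed.longestRepeatedPrefix {w h : List α} (hw : w ≠ []) (hclosed : Closed w)
    (hh : IsLongestRepeatedPrefix h w) :
    h.length < w.length ∧ h <+: w ∧ h <:+ w ∧ occurrences h w = {0, w.length - h.length} := by
  obtain ⟨z, hne, hpre, hsuf, hcard⟩ := hclosed.resolve_left hw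
  obtain ⟨hlt, hocc⟩ := occurrences_eq_of_border hne hpre hsuf hcard
  have hzh : z.length ≤ h.length := hh.2 z hpre hcard.ge
  have hpz : z <+: h := List.prefix_of_prefix_length_le hpre hh.1.1 hzh
  obtain ⟨i, hi, hi0⟩ := exists_mem_ne (by have := hh.1.2; omega : 1 < (occurrences h w).card) 0
  obtain ⟨hil, hih⟩ := mem_occurrences.1 hi
  have hiz : i ∈ occurrences z w := mem_occurrences.2 ⟨hil, hpz.trans hih⟩
  rw [hocc] at hiz
  simp only [mem_insert, mem_singleton, hi0, false_or] at hiz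
  have hle := hih.length_le
  rw [List.length_drop] at hle
  obtain rfl : z = h := hpz.eq_of_length (by omega)
  exact ⟨hlt, hpre, hsuf, hocc⟩

/-- Another occurrence of the suffix of length |h| + 1 would put `h` strictly between the two ends;
shorter suffixes recur inside the prefix `h`. -/
theorem K_eq_of_border {w h : List α} (hlt : h.length < w.length) (hsuf : h <:+ w)
    (hocc : occurrences h w = {0, w.length - h.length}) : K w = h.length + 1 := by
  refine IsLeast.csInf_eq ⟨?_, ?_⟩
  · have hsl : (w.drop (w.length - h.length - 1)).length = h.length + 1 := by simp; omega
    refine ⟨_, List.drop_suffix (w.length - h.length - 1) w, hsl, card_eq_one.2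
      ⟨w.length - h.length - 1, eq_singleton_iff_unique_mem.2 ⟨?_, ?_⟩⟩⟩
    · exact mem_occurrences.2 ⟨by omega, List.prefix_rfl⟩
    · intro i hi
      obtain ⟨-, hpre⟩ := mem_occurrences.1 hi
      have hle := hpre.length_le
      rw [hsl, List.length_drop] at hle
      have h1 : h <+: w.drop (i + 1) := by
        have := hpre.drop 1
        rw [List.drop_drop, List.drop_drop,
          show w.length - h.length - 1 + 1 = w.length - h.length by omega,
          ← List.suffix_iff_eq_drop.1 hsuf] at this
        exact this
      have h2 : i + 1 ∈ occurrences h w := mem_occurrences.2 ⟨by omega, h1⟩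
      rw [hocc] at h2
      simp only [mem_insert, mem_singleton] at h2
      omega
  · rintro n ⟨z, hz, rfl, hcard⟩
    by_contra! hn
    have hzh : z <:+ h := List.suffix_of_suffix_length_le hz hsuf (by omega)
    have hpre : h <+: w := by
      have : 0 ∈ occurrences h w := by rw [hocc]; simp
      simpa using (mem_occurrences.1 this).2
    have h1 : h.length - z.length ∈ occurrences z w := by
      refine mem_occurrences.2 ⟨by omega, ?_⟩
      have := hpre.drop (h.length - z.length)
      rwa [← List.suffix_iff_eq_drop.1 hzh] at this
    have := card_le_one.1 hcard.le _ h1 _ (sub_mem_occurrences hz)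
    omega

/-- Complexity is m + 1 on the plateau and descends by ones from M to the value 1 at |w|, so |w| - M
= m. -/
theorem Trapezoidal.R_add_K {w : List α} (hw : Trapezoidal w) (hK : K w ≤ w.length) :
    R w + K w = w.length := by
  obtain ⟨-, hup, hflat, hdown⟩ := hw
  have hM : max (R w) (K w) ≤ w.length := max_le (R_le_length w) hK
  have hmM : min (R w) (K w) ≤ max (R w) (K w) := min_le_max
  have hsum := min_add_max (R w) (K w)
  generalize min (R w) (K w) = m at *
  generalize max (R w) (K w) = M at *
  have h1 : complexity w M = m + 1 := by
    refine Nat.le_induction (m := m) (P := fun i _ => i ≤ M → complexity w i = m + 1)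
      (fun _ => hup m le_rfl) (fun i hi ih hiM => ?_) M hmM le_rfl
    rw [hflat i hi hiM, ih (by omega)]
  have h2 : complexity w w.length + w.length = complexity w M + M := by
    refine Nat.le_induction (m := M)
      (P := fun i _ => i ≤ w.length → complexity w i + i = complexity w M + M)
      (fun _ => rfl) (fun i hi ih hiM => ?_) w.length hM le_rfl
    have := hdown i hi (by omega)
    have := ih (by omega)
    omega
  rw [complexity_length] at h2
  omega

theorem sturmian_and_exists_reflect {w : List α} {p : ℕ} [NeZero p] {x : ZMod p → α}
    (hx : w = window x 0 w.length) (hR : R w + 1 = p) :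
    Sturmian w ∧ ∃ s, ∀ m, x (s - m) = x m := by
  have hp : 0 < p := by omega
  rcases Nat.lt_or_ge 1 p with h1 | h1
  -- Here p - 2 = R - 1 is below the infimum defining R.
  · have hnot : p - 2 ∉ {n : ℕ | ∀ z : List α, z.length = n → ¬ RightSpecial z w} :=
      Nat.notMem_of_lt_sInf (by change p - 2 < R w; omega)
    simp only [Set.mem_ofPred_eq, not_forall, not_not] at hnot
    obtain ⟨z, hz, hrs⟩ := hnot
    rw [hx] at hrs ⊢
    exact balanced_and_reflect_of_rightSpecial h1 hz hrs
  -- For p = 1 the word is constant.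
  · obtain rfl : p = 1 := by omega
    refine ⟨fun a u v hu hv huv => ?_, 0, fun m => congrArg x (Subsingleton.elim _ _)⟩
    rw [hx] at hu hv
    obtain ⟨m, hm⟩ := exists_window_of_infix hu
    obtain ⟨m', hm'⟩ := exists_window_of_infix hv
    rw [hm, hm', huv, Subsingleton.elim m m']
    simp

end Closed

end Word

theorem proposition4p8 {α : Type*} [Fintype α] [DecidableEq α] (hα : Fintype.card α = 2)
    (w h : List α) (hclosed : Word.Closed w) (htrap : Word.Trapezoidal w)
    (hh : Word.IsLongestRepeatedPrefix h w) :
    (Word.Sturmian w ∧ w.Palindrome) ↔ h.Palindrome := by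
  obtain ⟨hlt, hpre, hsuf, hocc⟩ := hclosed.longestRepeatedPrefix htrap.1 hh
  have hrev : h.reverse <+: w.reverse := List.reverse_prefix.2 hsuf
  constructor
  · rintro ⟨-, hw⟩
    rw [hw.reverse_eq] at hrev
    exact .of_reverse_eq ((List.prefix_of_prefix_length_le hrev hpre (by simp)).eq_of_length
      (by simp))
  · intro hpal
    rw [hpal.reverse_eq] at hrev
    have hK := Word.K_eq_of_border hlt hsuf hocc
    have hRK := htrap.R_add_K (by omega)
    obtain ⟨p, hp⟩ : ∃ p, p = w.length - h.length := ⟨_, rfl⟩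
    have : NeZero p := ⟨by omega⟩
    obtain ⟨x, hx⟩ := Word.exists_eq_window (p := p) (by omega) hpre hsuf
    obtain ⟨hst, s, hs⟩ := Word.sturmian_and_exists_reflect hx (by omega)
    refine ⟨hst, .of_reverse_eq ?_⟩
    have hwr : w.reverse = Word.window x (s + 1 - 0 - w.length) w.length := by
      rw [← Word.reverse_window hs, ← hx]
    generalize s + 1 - 0 - (w.length : ZMod p) = q at hwr
    have hq : q.val < p := ZMod.val_lt q
    have hhq : h = Word.window x q h.length := by
      rw [hwr] at hrev
      rw [← Word.take_window x q hlt.le]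
      exact List.prefix_iff_eq_take.1 hrev
    -- The representative below p excludes the end occurrence, forcing q = 0.
    have hmem : q.val ∈ Word.occurrences h w := by
      refine Word.mem_occurrences.2 ⟨by omega, List.prefix_iff_eq_take.2 ?_⟩
      rw [hx, Word.drop_window, Word.take_window _ _ (by omega), zero_add,
        ZMod.natCast_zmod_val]
      exact hhq
    rw [hocc] at hmem
    simp only [Finset.mem_insert, Finset.mem_singleton] at hmem
    have hq0 : q = 0 := (ZMod.val_eq_zero q).1 (by omega)
    rw [hwr, hq0, ← hx]
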